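/- Let $S$ be a non-exceptional connected Riemann surface, that is, one whose fundamental group is not abelian, and let $\mathbb{H}\to S$ be a holomorphic universal covering with deck group $\Gamma$ (a torsion-free Fuchsian group with $S=\mathbb{H}/\Gamma$). Let $k\in\{2,3,\ldots\}\cup\{\infty\}$; put $\mathbb{Z}_k=\mathbb{Z}/k\mathbb{Z}$ for finite $k$ and $\mathbb{Z}_\infty=\mathbb{Z}$. Let $\Gamma_k$ be the subgroup of $\Gamma$ generated by all commutators and, if $k$ is finite, by all $k$-th powers of elements of $\Gamma$. Let $\widetilde S_k=\mathbb{H}/\Gamma_k$ be the $k$-homology cover of $S$, let $\pi_k:\widetilde S_k\to S$ be the induced covering, and let $M_k\cong H_1(S;\mathbb{Z}_k)$ be its deck group. For $L\le \mathrm{Aut}(S)$ (the group of conformal automorphisms), let $\widetilde L_k$ be the group of those $\psi\in\mathrm{Aut}(\widetilde S_k)$ normalizing $M_k$ for which there is an element $\theta_k(\psi)\in L$ with $\pi_k\circ\psi=\theta_k(\psi)\circ\pi_k$. Let $L\le\mathrm{Aut}(S)$ and let $\phi\in L$ have finite order $l$. Suppose that either (i) $\phi$ has fixed points, or (ii) $k$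 is finite and $k$ and $l$ are relatively prime. Then there exists $\Psi\in\widetilde L_k$ of order $l$ with $\theta_k(\Psi)=\phi$, which has fixed points if $\phi$ does. In particular, for $L=\langle\phi\rangle$, $\widetilde L_k$ is the internal semidirect product $M_k\rtimes\langle\Psi\rangle$, and $\widetilde L_k\cong H_1(S;\mathbb{Z}_k)\rtimes\mathbb{Z}_l$ by an isomorphism taking $M_k$ onto $H_1(S;\mathbb{Z}_k)$ and $\Psi$ to the generator $1$ of $\mathbb{Z}_l$; if $S$ is a closed surface of genus $g$, then likewise $\widetilde L_k\cong\mathbb{Z}_k^{2g}\rtimes\mathbb{Z}_l$. -/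

import Mathlib

open scoped UpperHalfPlane Manifold ContDiff Topology TensorProduct commutatorElement

/-! ## Holomorphic automorphisms -/

/-- The group `Aut(X)` of conformal automorphisms of `X`: the homeomorphisms of `X` onto itself
that are holomorphic together with their inverse. -/
def ConformalAut (X : Type*) [TopologicalSpace X] [ChartedSpace ℂ X] : Subgroup (X ≃ₜ X) where
  carrier := {f | MDifferentiable 𝓘(ℂ) 𝓘(ℂ) f ∧ MDifferentiable 𝓘(ℂ) 𝓘(ℂ) f.symm}
  one_mem' := ⟨mdifferentiable_id, mdifferentiable_id⟩
  mul_mem' := fun {_ _} hf hg => ⟨hf.1.comp hg.1, hg.2.comp hf.2⟩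
  inv_mem' := fun {_} hf => ⟨hf.2, hf.1⟩

namespace ConformalAut

variable {X : Type*} [TopologicalSpace X] [ChartedSpace ℂ X]

/-- The tautological action of `Aut(X)` on `X`. -/
instance : MulAction (ConformalAut X) X where
  smul f x := f.1 x
  one_smul _ := rfl
  mul_smul _ _ _ := rfl

theorem smul_def (f : ConformalAut X) (x : X) : f • x = f.1 x := rfl

/-- The fixed points of an automorphism. -/
def Fix (f : ConformalAut X) : Set X := {x | f • x = x}

end ConformalAut

/-! ## The subgroups `G_k` and the groups `ℤ_k`, `H₁(S; ℤ_k)` -/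

/-- The subgroup `G_k` of `G` generated by all commutators and, if `k` is finite, by all `k`-th
powers. -/
def homologySubgroup (G : Type*) [Group G] (k : ℕ∞) : Subgroup G :=
  Subgroup.closure ({x | ∃ a b : G, x = ⁅a, b⁆} ∪ {x | ∃ n : ℕ, k = n ∧ ∃ a : G, x = a ^ n})

/-- The group `ℤ_k`: it is `ℤ/kℤ` for finite `k`, and `ℤ` for `k = ∞` (as `ENat.toNat ⊤ = 0` and
`ZMod 0 = ℤ`). -/
abbrev ZCoeff (k : ℕ∞) : Type := ZMod k.toNat

/-- The first homology group `H₁(S; ℤ)` of a path-connected space, as the abelianization of the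
fundamental group. -/
abbrev H1 (S : Type*) [TopologicalSpace S] (x₀ : S) : Type _ :=
  Additive (Abelianization (FundamentalGroup S x₀))

/-- The first homology group `H₁(S; ℤ_k) = H₁(S; ℤ) ⊗ ℤ_k` of a path-connected space. -/
abbrev H1Coeff (S : Type*) [TopologicalSpace S] (x₀ : S) (k : ℕ∞) : Type _ :=
  H1 S x₀ ⊗[ℤ] ZCoeff k

/-- The group `⟨a₁, b₁, …, a_g, b_g | [a₁, b₁] ⋯ [a_g, b_g] = 1⟩`. -/
abbrev SurfaceGroup (g : ℕ) : Type :=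
  PresentedGroup ({(List.ofFn fun i : Fin g =>
    ⁅FreeGroup.of (Sum.inl i : Fin g ⊕ Fin g), FreeGroup.of (Sum.inr i)⁆).prod} :
      Set (FreeGroup (Fin g ⊕ Fin g)))

/-- The connected Riemann surface `S` is closed of genus `g`: it is compact, and its fundamental
group is that of the closed orientable surface with `g` handles (which determines the surface up
to homeomorphism). -/
def IsClosedOfGenus (S : Type*) [TopologicalSpace S] (x₀ : S) (g : ℕ) : Prop :=
  CompactSpace S ∧ Nonempty (FundamentalGroup S x₀ ≃* SurfaceGroup g)

/-! ## Non-exceptional surfaces and their uniformization -/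

/-- A connected surface is non-exceptional if its fundamental group is not abelian. -/
def IsNonExceptional (S : Type*) [TopologicalSpace S] (x₀ : S) : Prop :=
  ∃ a b : FundamentalGroup S x₀, a * b ≠ b * a

/-- A holomorphic universal covering of the Riemann surface `S` by the hyperbolic plane. -/
structure Uniformization (S : Type*) [TopologicalSpace S] [ChartedSpace ℂ S] where
  /-- the covering map -/
  proj : ℍ → S
  isCoveringMap : IsCoveringMap proj
  mdifferentiable : MDifferentiable 𝓘(ℂ) 𝓘(ℂ) proj

namespace Uniformization

variable {S : Type*} [TopologicalSpace S] [ChartedSpace ℂ S] (u : Uniformization S)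

/-- The group `Γ` of deck transformations, for which `S = ℍ/Γ`. -/
noncomputable def Γ : Subgroup (ConformalAut ℍ) where
  carrier := {γ | ∀ z, u.proj (γ • z) = u.proj z}
  one_mem' _ := rfl
  mul_mem' {a b} ha hb z := by rw [mul_smul, ha, hb]
  inv_mem' {a} ha z := by rw [← ha, smul_inv_smul]

/-- The subgroup `Γ_k` of `Γ`. -/
noncomputable abbrev Γk (k : ℕ∞) : Subgroup u.Γ := homologySubgroup u.Γ k

/-- The `k`-homology cover `ℍ/Γ_k` of `S`. -/
noncomputable def HomologyCover (k : ℕ∞) : Type := MulAction.orbitRel.Quotient (u.Γk k) ℍ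

variable (k : ℕ∞)

instance : TopologicalSpace (u.HomologyCover k) :=
  inferInstanceAs (TopologicalSpace (MulAction.orbitRel.Quotient (u.Γk k) ℍ))

/-- The quotient map `ℍ → ℍ/Γ_k`. -/
noncomputable def toCover : ℍ → u.HomologyCover k := Quotient.mk _

theorem toCover_surjective : Function.Surjective (u.toCover k) := Quotient.mk_surjective

theorem proj_smul (γ : u.Γk k) (z : ℍ) : u.proj (γ • z) = u.proj z := γ.1.2 z

theorem toCover_eq_iff {z w : ℍ} : u.toCover k z = u.toCover k w ↔ z ∈ MulAction.orbit (u.Γk k) w :=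
  Quotient.eq (r := MulAction.orbitRel (u.Γk k) ℍ)

instance : ContinuousConstSMul (u.Γk k) ℍ where
  continuous_const_smul γ := γ.1.1.1.continuous

theorem isQuotientCoveringMap_toCover : IsQuotientCoveringMap (u.toCover k) (u.Γk k) where
  toIsQuotientMap := isQuotientMap_quot_mk
  continuous_const_smul := continuous_const_smul
  apply_eq_iff_mem_orbit := u.toCover_eq_iff k
  disjoint e := by
    obtain ⟨U, hU, he, hinj⟩ := u.isCoveringMap.isLocalHomeomorph.isLocallyInjective e
    refine ⟨U, hU.mem_nhds he, ?_⟩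
    rintro γ ⟨_, ⟨z, hz, rfl⟩, hz'⟩
    have hfix : γ • z = z := hinj hz' hz (u.proj_smul k γ z)
    have h : (fun w : ℍ => γ • w) = id :=
      u.isCoveringMap.eq_of_comp_eq (continuous_const_smul γ) continuous_id
        (funext fun w => u.proj_smul k γ w) z hfix
    exact Subtype.ext (Subtype.ext (Subtype.ext (Homeomorph.ext fun w => congrFun h w)))

theorem isLocalHomeomorph_toCover : IsLocalHomeomorph (u.toCover k) :=
  (u.isQuotientCoveringMap_toCover k).isCoveringMap.isLocalHomeomorph

/-- The charts of `ℍ/Γ_k`: local inverses of `ℍ → ℍ/Γ_k`, followed by `ℍ → ℂ`. -/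
noncomputable instance : ChartedSpace ℂ (u.HomologyCover k) :=
  (u.isLocalHomeomorph_toCover k).chartedSpace (u.toCover_surjective k)

/-- `ℍ/Γ_k` is a Riemann surface: the transition maps of the above charts are holomorphic. -/
instance : IsManifold 𝓘(ℂ) ω (u.HomologyCover k) := by
  have hloc := u.isLocalHomeomorph_toCover k
  refine isManifold_of_contDiffOn _ _ _ ?_
  rintro _ _ ⟨q, rfl⟩ ⟨q', rfl⟩
  generalize (u.toCover_surjective k).hasRightInverse.choose q = a
  generalize (u.toCover_surjective k).hasRightInverse.choose q' = b
  rintro w ⟨⟨hw1, hw2⟩, -⟩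
  refine ContDiffAt.contDiffWithinAt ?_
  have hF : ∀ v : ℂ, (𝓘(ℂ, ℂ) ∘ (((hloc.localInverseAt a).trans (chartAt ℂ a)).symm.trans
      ((hloc.localInverseAt b).trans (chartAt ℂ b))) ∘ 𝓘(ℂ, ℂ).symm) v =
      (hloc.localInverseAt b (u.toCover k (UpperHalfPlane.ofComplex v)) : ℂ) := fun v =>
    congrArg (fun x => ((hloc.localInverseAt b x : ℍ) : ℂ))
      (congrFun (hloc.localInverseAt_symm (x := a)) (UpperHalfPlane.ofComplex v))
  have hwim : 0 < w.im := by
    have h := hw1.1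
    change w ∈ (UpperHalfPlane.isOpenEmbedding_coe.toOpenPartialHomeomorph _).target at h
    rw [Topology.IsOpenEmbedding.toOpenPartialHomeomorph_target] at h
    obtain ⟨z, rfl⟩ := h
    exact z.im_pos
  obtain ⟨z, rfl⟩ : ∃ z : ℍ, (z : ℂ) = w := ⟨⟨w, hwim⟩, rfl⟩
  have hsrc : u.toCover k z ∈ (hloc.localInverseAt b).source := by
    have h : (hloc.localInverseAt a).symm (UpperHalfPlane.ofComplex (z : ℂ)) ∈
      (hloc.localInverseAt b).source := hw2.1
    rwa [hloc.localInverseAt_symm, UpperHalfPlane.ofComplex_apply] at h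
  obtain ⟨γ, hγ⟩ : ∃ γ : u.Γk k, γ • z = hloc.localInverseAt b (u.toCover k z) :=
    (u.toCover_eq_iff k).1 (hloc.apply_localInverseAt_of_mem hsrc)
  have hev : ∀ᶠ v in 𝓝 z, hloc.localInverseAt b (u.toCover k v) = γ • v := by
    have h1 : ∀ᶠ v in 𝓝 z, u.toCover k v ∈ (hloc.localInverseAt b).source :=
      hloc.continuous.continuousAt.eventually
        ((hloc.localInverseAt b).open_source.mem_nhds hsrc)
    have h2 : ∀ᶠ v in 𝓝 z, γ • v ∈ (hloc.localInverseAt b).target := by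
      refine (continuous_const_smul γ).continuousAt.eventually
        ((hloc.localInverseAt b).open_target.mem_nhds ?_)
      change γ • z ∈ _
      rw [hγ]
      exact (hloc.localInverseAt b).map_source hsrc
    filter_upwards [h1, h2] with v hv1 hv2
    refine hloc.injOn_localInverseAt_target ((hloc.localInverseAt b).map_source hv1) hv2 ?_
    rw [hloc.apply_localInverseAt_of_mem hv1]
    exact (u.toCover_eq_iff k).2 ⟨γ⁻¹, inv_smul_smul γ v⟩
  have hγd : MDifferentiable 𝓘(ℂ) 𝓘(ℂ) (fun v : ℍ => ((γ • v : ℍ) : ℂ)) :=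
    UpperHalfPlane.mdifferentiable_coe.comp γ.1.1.2.1
  have hopen : IsOpen {z : ℂ | 0 < z.im} := isOpen_lt continuous_const Complex.continuous_im
  have hcd := ((UpperHalfPlane.mdifferentiable_iff.1 hγd).analyticAt
    (hopen.mem_nhds z.im_pos)).contDiffAt (n := ω)
  refine hcd.congr_of_eventuallyEq ?_
  have hof : Filter.Tendsto UpperHalfPlane.ofComplex (𝓝 (z : ℂ)) (𝓝 z) := by
    have h := (UpperHalfPlane.mdifferentiableAt_ofComplex z.im_pos).continuousAt
    rwa [ContinuousAt, UpperHalfPlane.ofComplex_apply] at h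
  filter_upwards [hof.eventually hev] with v hv
  rw [hF, hv]
  rfl

/-- The covering `π_k : ℍ/Γ_k → S` induced by `ℍ → S`. -/
noncomputable def π : u.HomologyCover k → S :=
  Quotient.lift u.proj (by rintro _ w ⟨γ, rfl⟩; exact u.proj_smul k γ w)

/-- The group `M_k` of deck transformations of `π_k`. -/
noncomputable def M : Subgroup (ConformalAut (u.HomologyCover k)) where
  carrier := {m | ∀ x, u.π k (m • x) = u.π k x}
  one_mem' _ := rfl
  mul_mem' {a b} ha hb x := by rw [mul_smul, ha, hb]
  inv_mem' {a} ha x := by rw [← ha, smul_inv_smul]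

/-- `ψ` is a lift of `φ`, that is, `π_k ∘ ψ = φ ∘ π_k`. For `ψ` in the normalizer of `M_k` this says
that `θ_k(ψ) = φ`. -/
def IsLift (ψ : ConformalAut (u.HomologyCover k)) (φ : ConformalAut S) : Prop :=
  ∀ x, u.π k (ψ • x) = φ • u.π k x

/-- The group `L̃_k = θ_k⁻¹(L)`: the automorphisms of `ℍ/Γ_k` which normalize `M_k` and induce an
element of `L` on `S`. -/
noncomputable def liftGroup (L : Subgroup (ConformalAut S)) :
    Subgroup (ConformalAut (u.HomologyCover k)) where
  carrier := {ψ | ψ ∈ Subgroup.normalizer (u.M k : Set (ConformalAut (u.HomologyCover k))) ∧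
    ∃ φ ∈ L, u.IsLift k ψ φ}
  one_mem' := ⟨one_mem _, 1, one_mem _, fun _ => rfl⟩
  mul_mem' := by
    rintro a b ⟨ha, φ, hφ, h⟩ ⟨hb, φ', hφ', h'⟩
    exact ⟨mul_mem ha hb, φ * φ', mul_mem hφ hφ', fun x => by rw [mul_smul, h, h', mul_smul]⟩
  inv_mem' := by
    rintro a ⟨ha, φ, hφ, h⟩
    refine ⟨inv_mem ha, φ⁻¹, inv_mem hφ, fun x => ?_⟩
    rw [eq_inv_smul_iff, ← h, smul_inv_smul]

end Uniformization

/-! ## Splittings -/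

/-- The group `G` is the internal semidirect product `M ⋊ ⟨Ψ⟩`. -/
def IsInternalSemidirect {G : Type*} [Group G] (M : Subgroup G) (Ψ : G) : Prop :=
  M.Normal ∧ M.IsComplement' (Subgroup.zpowers Ψ)

/-- There is an isomorphism from `G` onto a semidirect product `A ⋊ ℤ_l` which takes `M` onto `A`
and `Ψ` to the canonical generator of `ℤ_l`. -/
def IsIsoSemidirect {G : Type*} [Group G] (M : Subgroup G) (Ψ : G) (A : Type*) [AddCommGroup A]
    (l : ℕ) : Prop :=
  ∃ (ρ : Multiplicative (ZMod l) →* MulAut (Multiplicative A))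
    (f : G ≃* Multiplicative A ⋊[ρ] Multiplicative (ZMod l)),
    M.map f.toMonoidHom = (SemidirectProduct.inl : _ →* Multiplicative A ⋊[ρ] _).range ∧
      f Ψ = SemidirectProduct.inr (Multiplicative.ofAdd 1)

/-! The automorphism `φ` lifts to an automorphism `F` of `ℍ`, because `ℍ` is simply connected.
Conjugation by `F` is an endomorphism of `Γ`, and every endomorphism maps `Γ_k` into itself. Hence
`F` descends to an automorphism of `ℍ/Γ_k` over `φ`, and only its order has to be controlled.

If `φ` fixes `p`, choose `F` fixing a point `z` over `p`. Then `F ^ l` covers the identity and fixes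
`z`, so it is the identity by uniqueness of lifts. The descended map has `l`-th power `1` and fixes
the class of `z`.

If `k` is finite and prime to `l`, start from any descended lift `ψ`. Now `ψ ^ l` lies in `M_k ≅
Γ/Γ_k`, which is killed by `k`. With `a ≡ 1` mod `l` and `a ≡ 0` mod `k`, the power `ψ ^ a` still
lies over `φ`, and its `l`-th power is `1`.

Since `π_k` is onto, `θ_k` is well defined. It has kernel `M_k`, so a lift of the same order as `φ`
splits it over `⟨φ⟩`. The kernel is identified through `Γ/Γ_k ≅ G/G_k ≅ H₁(S; ℤ_k)`, with `G` the
fundamental group. For a surface group, `G/G_k` is free over `ℤ_k` on the `2g` generators. -/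

section HomologySubgroup

/-! ### The quotient `G / G_k` and homology with coefficients -/

variable {G H : Type*} [Group G] [Group H] (k : ℕ∞)

theorem homologySubgroup_le_iff {K : Subgroup G} : homologySubgroup G k ≤ K ↔
    (∀ a b : G, ⁅a, b⁆ ∈ K) ∧ ∀ n : ℕ, k = n → ∀ a : G, a ^ n ∈ K := by
  rw [homologySubgroup, Subgroup.closure_le]
  constructor
  · intro h
    exact ⟨fun a b => h (Or.inl ⟨a, b, rfl⟩), fun n hn a => h (Or.inr ⟨n, hn, a, rfl⟩)⟩
  · rintro ⟨h₁, h₂⟩ x (⟨a, b, rfl⟩ | ⟨n, hn, a, rfl⟩)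
    exacts [h₁ a b, h₂ n hn a]

theorem commutator_mem_homologySubgroup (a b : G) : ⁅a, b⁆ ∈ homologySubgroup G k :=
  ((homologySubgroup_le_iff k).1 le_rfl).1 a b

/-- For `k = ∞` the exponent is `0`, so the claim is only `1 ∈ G_k`; this lets finite and infinite
`k` be treated together. -/
theorem pow_mem_homologySubgroup (a : G) : a ^ k.toNat ∈ homologySubgroup G k := by
  induction k using ENat.recTopCoe with
  | top => simp
  | coe n => simpa using ((homologySubgroup_le_iff (n : ℕ∞)).1 le_rfl).2 n rfl a

/-- Homomorphisms preserve commutators and powers. Applied to endomorphisms, this gives normality of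
`G_k` and the descent of lifts to `ℍ/Γ_k`. -/
theorem map_homologySubgroup_le (f : G →* H) :
    (homologySubgroup G k).map f ≤ homologySubgroup H k := by
  rw [Subgroup.map_le_iff_le_comap, homologySubgroup_le_iff]
  refine ⟨fun a b => ?_, ?_⟩
  · rw [Subgroup.mem_comap, map_commutatorElement]
    exact commutator_mem_homologySubgroup k _ _
  · rintro n rfl a
    rw [Subgroup.mem_comap, map_pow]
    simpa using pow_mem_homologySubgroup (n : ℕ∞) (f a)

instance homologySubgroup_normal : (homologySubgroup G k).Normal where
  conj_mem _ hx g :=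
    map_homologySubgroup_le k (MulAut.conj g).toMonoidHom (Subgroup.mem_map_of_mem _ hx)

theorem map_homologySubgroup_equiv (e : G ≃* H) :
    (homologySubgroup G k).map (e : G →* H) = homologySubgroup H k := by
  refine le_antisymm (map_homologySubgroup_le k _) fun x hx => ?_
  exact ⟨e.symm x, map_homologySubgroup_le k e.symm.toMonoidHom (Subgroup.mem_map_of_mem _ hx),
    e.apply_symm_apply x⟩

/-- An isomorphism `G ≃* H` induces an isomorphism `G / G_k ≃* H / H_k`. -/
def homologyQuotientCongr (e : G ≃* H) :
    G ⧸ homologySubgroup G k ≃* H ⧸ homologySubgroup H k :=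
  QuotientGroup.congr _ _ e (map_homologySubgroup_equiv k e)

instance homologyQuotientCommGroup : CommGroup (G ⧸ homologySubgroup G k) where
  __ := QuotientGroup.Quotient.group _
  mul_comm a b := by
    induction a using QuotientGroup.induction_on with | _ a
    induction b using QuotientGroup.induction_on with | _ b
    rw [← QuotientGroup.mk_mul, ← QuotientGroup.mk_mul, QuotientGroup.eq]
    simpa [commutatorElement_def, mul_assoc] using commutator_mem_homologySubgroup k b⁻¹ a⁻¹

theorem homologyQuotient_nsmul_eq_zero (x : Additive (G ⧸ homologySubgroup G k)) :
    k.toNat • x = 0 := by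
  obtain ⟨a, ha⟩ := QuotientGroup.mk_surjective x.toMul
  obtain rfl : Additive.ofMul (a : G ⧸ homologySubgroup G k) = x := congrArg Additive.ofMul ha
  exact congrArg Additive.ofMul ((QuotientGroup.eq_one_iff _).2 (pow_mem_homologySubgroup k a))

noncomputable instance homologyQuotientModule :
    Module (ZCoeff k) (Additive (G ⧸ homologySubgroup G k)) :=
  AddCommGroup.zmodModule (homologyQuotient_nsmul_eq_zero k)

variable {k}

/-- A surjection `f` of `G` onto a commutative group killed by `k`, through which `G → G / G_k`
factors, induces an isomorphism of `G / G_k`. -/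
noncomputable def homologyQuotientEquiv {A : Type*} [AddCommGroup A]
    (hA : ∀ a : A, k.toNat • a = 0) (f : G →* Multiplicative A) (hf : Function.Surjective f)
    (s : A → G ⧸ homologySubgroup G k) (hs : ∀ g, s (f g).toAdd = g) :
    G ⧸ homologySubgroup G k ≃* Multiplicative A :=
  MulEquiv.ofBijective
    (QuotientGroup.lift (homologySubgroup G k) f (by
      change homologySubgroup G k ≤ f.ker
      refine (homologySubgroup_le_iff k).2 ⟨fun a b => ?_, ?_⟩
      · rw [MonoidHom.mem_ker, map_commutatorElement, commutatorElement_eq_one_iff_commute]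
        exact Commute.all _ _
      · rintro n rfl a
        rw [MonoidHom.mem_ker, map_pow]
        simpa using congrArg Multiplicative.ofAdd (hA (f a).toAdd)))
    -- Injectivity: `s` recovers the class of `g` from `f g`, and need not be a homomorphism for
    -- this.
    ⟨fun a b h => by
      induction a using QuotientGroup.induction_on with | _ a
      induction b using QuotientGroup.induction_on with | _ b
      rw [← hs a, ← hs b]
      exact congrArg (fun x => s (Multiplicative.toAdd x)) h,
    fun a => by
      obtain ⟨g, rfl⟩ := hf a
      exact ⟨g, rfl⟩⟩

theorem zcoeff_intCast_surjective : Function.Surjective ((↑) : ℤ → ZCoeff k) :=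
  ZMod.intCast_surjective

theorem zcoeff_nsmul_eq_zero (c : ZCoeff k) : k.toNat • c = 0 := by
  rw [nsmul_eq_mul, ZMod.natCast_self, zero_mul]

variable (G k)

/-- `G / G_k` is the abelianization of `G` with coefficients in `ℤ_k`. -/
noncomputable def homologyQuotientEquivTensor :
    G ⧸ homologySubgroup G k ≃*
      Multiplicative (Additive (Abelianization G) ⊗[ℤ] ZCoeff k) := by
  let Q := Additive (G ⧸ homologySubgroup G k)
  let ab : Additive (Abelianization G) →+ Q :=
    MonoidHom.toAdditive (Abelianization.lift (QuotientGroup.mk' (homologySubgroup G k)))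
  let B : Additive (Abelianization G) →+ ZCoeff k →+ Q :=
    AddMonoidHom.flip
      { toFun := fun c => (DistribSMul.toAddMonoidHom Q c).comp ab
        map_zero' := by ext; simp
        map_add' := fun c d => by ext; simp [add_smul] }
  -- The inverse map: a pure tensor `x ⊗ c` goes to `c` times the class of `x`.
  let s : Additive (Abelianization G) ⊗[ℤ] ZCoeff k →+ Q :=
    TensorProduct.liftAddHom B (fun r m n => by
      change n • ab (r • m) = (r • n) • ab m
      rw [map_zsmul, smul_comm, smul_assoc])
  let f : G →* Multiplicative (Additive (Abelianization G) ⊗[ℤ] ZCoeff k) :=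
    { toFun := fun g => Multiplicative.ofAdd (Additive.ofMul (Abelianization.of g) ⊗ₜ 1)
      map_one' := by simp
      map_mul' := fun a b => by simp [TensorProduct.add_tmul] }
  refine homologyQuotientEquiv (fun a => ?_) f (fun a => ?_) (fun a => (s a).toMul) fun g => ?_
  · induction a using TensorProduct.induction_on with
    | zero => simp
    | add x y hx hy => rw [smul_add, hx, hy, add_zero]
    | tmul x c =>
      rw [← TensorProduct.tmul_smul, zcoeff_nsmul_eq_zero, TensorProduct.tmul_zero]
  · obtain ⟨a, rfl⟩ := Multiplicative.ofAdd.surjective a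
    induction a using TensorProduct.induction_on with
    | zero => exact ⟨1, map_one f⟩
    | add x y hx hy =>
      obtain ⟨a, ha⟩ := hx
      obtain ⟨b, hb⟩ := hy
      exact ⟨a * b, by rw [map_mul, ha, hb, ofAdd_add]⟩
    | tmul x c =>
      -- Every scalar comes from an integer `n`, so the tensor is `n • (x ⊗ 1)`, the image of `g ^
      -- n`.
      obtain ⟨n, rfl⟩ := zcoeff_intCast_surjective c
      obtain ⟨g, hg⟩ := QuotientGroup.mk_surjective x.toMul
      obtain rfl : Additive.ofMul (Abelianization.of g) = x := congrArg Additive.ofMul hg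
      refine ⟨g ^ n, ?_⟩
      rw [map_zpow]
      change Multiplicative.ofAdd (n • (Additive.ofMul (Abelianization.of g) ⊗ₜ (1 : ZCoeff k))) = _
      rw [← TensorProduct.tmul_smul, zsmul_one]
  · change ((1 : ZCoeff k) • ab (Additive.ofMul (Abelianization.of g))).toMul = _
    rw [one_smul]
    rfl

/-- For the surface group `G` of genus `g`, the group `G / G_k` is free over `ℤ_k` on the
generators. -/
noncomputable def surfaceGroupHomologyQuotientEquiv (g : ℕ) :
    SurfaceGroup g ⧸ homologySubgroup (SurfaceGroup g) k ≃*
      Multiplicative (Fin g ⊕ Fin g → ZCoeff k) := by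
  let Q := Additive (SurfaceGroup g ⧸ homologySubgroup (SurfaceGroup g) k)
  let b : Fin g ⊕ Fin g → Q := fun i => Additive.ofMul (QuotientGroup.mk (PresentedGroup.of i))
  let s : (Fin g ⊕ Fin g → ZCoeff k) →ₗ[ZCoeff k] Q := Fintype.linearCombination (ZCoeff k) b
  let f : SurfaceGroup g →* Multiplicative (Fin g ⊕ Fin g → ZCoeff k) :=
    PresentedGroup.toGroup (f := fun i => Multiplicative.ofAdd (Pi.single i 1)) (by
      rintro _ rfl
      rw [map_list_prod]
      refine List.prod_eq_one fun x hx => ?_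
      obtain ⟨y, hy, rfl⟩ := List.mem_map.1 hx
      obtain ⟨i, rfl⟩ := List.mem_ofFn.1 hy
      rw [map_commutatorElement, commutatorElement_eq_one_iff_commute]
      exact Commute.all _ _)
  refine homologyQuotientEquiv (fun a => ?_) f (fun a => ?_) (fun a => (s a).toMul) fun x => ?_
  · ext i
    rw [Pi.smul_apply, zcoeff_nsmul_eq_zero, Pi.zero_apply]
  · obtain ⟨a, rfl⟩ := Multiplicative.ofAdd.surjective a
    rw [← MonoidHom.mem_range, ← Finset.univ_sum_single a, ofAdd_sum]
    refine Subgroup.prod_mem _ fun i _ => ?_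
    obtain ⟨n, hn⟩ := zcoeff_intCast_surjective (a i)
    refine ⟨PresentedGroup.of i ^ n, ?_⟩
    rw [map_zpow, PresentedGroup.toGroup.of, ← ofAdd_zsmul, ← Pi.single_smul, zsmul_one, hn]
  -- As a homomorphism, `s ∘ f` can be compared with the quotient map on generators alone.
  · let s' : Multiplicative (Fin g ⊕ Fin g → ZCoeff k) →*
        SurfaceGroup g ⧸ homologySubgroup (SurfaceGroup g) k :=
      { toFun := fun a => (s a.toAdd).toMul
        map_one' := by simp
        map_mul' := fun a b => congrArg Additive.toMul (map_add s _ _) }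
    have h : s'.comp f = QuotientGroup.mk' (homologySubgroup (SurfaceGroup g) k) := by
      refine PresentedGroup.ext fun i => ?_
      change (s (f (PresentedGroup.of i)).toAdd).toMul = _
      rw [PresentedGroup.toGroup.of, toAdd_ofAdd, Fintype.linearCombination_apply_single, one_smul]
      rfl
    exact DFunLike.congr_fun h x

end HomologySubgroup

/-! ### From a complement to a semidirect product -/

theorem isIsoSemidirect_of_isComplement' {G : Type*} [Group G] {M : Subgroup G} [M.Normal] {Ψ : G}
    (h : M.IsComplement' (Subgroup.zpowers Ψ)) {A : Type*} [AddCommGroup A]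
    (e : M ≃* Multiplicative A) {l : ℕ} (hl : orderOf Ψ = l) : IsIsoSemidirect M Ψ A l := by
  have hc : Nat.card (Subgroup.zpowers Ψ) = l := by rw [Nat.card_zpowers, hl]
  have hg : ∀ x, x ∈ Subgroup.zpowers (⟨Ψ, Subgroup.mem_zpowers Ψ⟩ : Subgroup.zpowers Ψ) := by
    rintro ⟨_, n, rfl⟩
    exact ⟨n, by ext; simp⟩
  let f₁ := SemidirectProduct.mulEquivSubgroup h
  let c := zmodMulEquivOfGenerator hg hc
  let f₂ := SemidirectProduct.congr' (φ₁ := M.normalizerMonoidHom.comp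
    (Subgroup.inclusion (M.normalizer_eq_top ▸ le_top))) e c.symm
  -- Setting `z = 1` gives the image of `M`, and setting `m = 1` gives the image of `Ψ`.
  have hf (m : M) (z : Subgroup.zpowers Ψ) :
      (f₁.symm.trans f₂) (m * z) = ⟨e m, c.symm z⟩ := by
    have : f₁.symm (m * z) = ⟨m, z⟩ := (MulEquiv.symm_apply_eq f₁).2 (by simp [f₁])
    rw [MulEquiv.trans_apply, this]
    rfl
  refine ⟨_, f₁.symm.trans f₂, ?_, ?_⟩
  · ext x
    simp only [Subgroup.mem_map, MonoidHom.mem_range]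
    constructor
    · rintro ⟨m, hm, rfl⟩
      refine ⟨e ⟨m, hm⟩, ?_⟩
      have := hf ⟨m, hm⟩ 1
      rw [map_one, OneMemClass.coe_one, mul_one] at this
      exact this.symm
    · rintro ⟨a, rfl⟩
      refine ⟨e.symm a, (e.symm a).2, ?_⟩
      have := hf (e.symm a) 1
      rw [map_one, OneMemClass.coe_one, mul_one, e.apply_symm_apply] at this
      exact this
  · have := hf 1 ⟨Ψ, Subgroup.mem_zpowers Ψ⟩
    rw [map_one, OneMemClass.coe_one, one_mul, zmodMulEquivOfGenerator_symm_apply_generator] at this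
    exact this

/-! ### Holomorphy of local inverses and of lifts -/

/-- The inverse of an injective holomorphic function is holomorphic. -/
theorem OpenPartialHomeomorph.differentiableOn_symm_of_complex (e : OpenPartialHomeomorph ℂ ℂ)
    (he : DifferentiableOn ℂ e e.source) : DifferentiableOn ℂ e.symm e.target := by
  intro w hw
  have hz := e.map_target hw
  have han : ∀ z ∈ e.source, AnalyticAt ℂ e z := fun z hz =>
    he.analyticAt (e.open_source.mem_nhds hz)
  -- Otherwise the derivative vanishes near the point and `e` is constant on a disc, against
  -- injectivity.
  have hd : ∀ᶠ z in 𝓝[≠] (e.symm w), deriv e z ≠ 0 := by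
    refine (han _ hz).deriv.eventually_eq_zero_or_eventually_ne_zero.resolve_left fun h0 => ?_
    obtain ⟨r, hr, hball⟩ := Metric.eventually_nhds_iff_ball.1
      (h0.and (e.open_source.mem_nhds hz))
    have hconst : ∀ z ∈ Metric.ball (e.symm w) r, e z = e (e.symm w) := fun z hz' =>
      Metric.isOpen_ball.is_const_of_deriv_eq_zero (convex_ball _ _).isPreconnected
        (he.mono fun z hz => (hball z hz).2) (fun z hz => (hball z hz).1) hz'
        (Metric.mem_ball_self hr)
    have hne : e.symm w + (r / 2 : ℝ) ≠ e.symm w := by simp [hr.ne']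
    have hmem : e.symm w + (r / 2 : ℝ) ∈ Metric.ball (e.symm w) r := by
      simp [abs_of_pos hr, hr]
    exact hne (e.injOn (hball _ hmem).2 hz (hconst _ hmem))
  -- Removable singularity: continuity at `w` suffices, so a zero of the derivative at `e.symm w`
  -- itself need not be excluded.
  refine (Complex.analyticAt_of_differentiable_on_punctured_nhds_of_continuousAt ?_
    (e.continuousAt_symm hw)).differentiableAt.differentiableWithinAt
  have hpunct : Filter.Tendsto e.symm (𝓝[≠] w) (𝓝[≠] (e.symm w)) := by
    refine tendsto_nhdsWithin_iff.2 ⟨(e.continuousAt_symm hw).tendsto.mono_left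
      nhdsWithin_le_nhds, ?_⟩
    filter_upwards [nhdsWithin_le_nhds (e.open_target.mem_nhds hw), self_mem_nhdsWithin]
      with v hv hvw h
    exact hvw (e.symm.injOn hv hw h)
  filter_upwards [hpunct.eventually hd, nhdsWithin_le_nhds (e.open_target.mem_nhds hw)] with v hv hvt
  exact (e.hasDerivAt_symm hvt hv
    (he.differentiableAt (e.open_source.mem_nhds (e.map_target hvt))).hasDerivAt).differentiableAt

/-- The inverse of a holomorphic open embedding between Riemann surfaces is holomorphic. -/
theorem OpenPartialHomeomorph.mdifferentiableOn_symm_of_complex {X Y : Type*} [TopologicalSpace X]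
    [ChartedSpace ℂ X] [IsManifold 𝓘(ℂ) ω X] [TopologicalSpace Y] [ChartedSpace ℂ Y]
    [IsManifold 𝓘(ℂ) ω Y] (e : OpenPartialHomeomorph X Y)
    (he : MDifferentiableOn 𝓘(ℂ) 𝓘(ℂ) e e.source) :
    MDifferentiableOn 𝓘(ℂ) 𝓘(ℂ) e.symm e.target := by
  have : IsManifold 𝓘(ℂ) 1 X := IsManifold.of_le (n := ω) le_top
  have : IsManifold 𝓘(ℂ) 1 Y := IsManifold.of_le (n := ω) le_top
  intro y hy
  let c := chartAt ℂ (e.symm y)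
  let d := chartAt ℂ y
  let q : OpenPartialHomeomorph ℂ ℂ := (c.symm.trans e).trans d
  have hc := mdifferentiable_chart (I := 𝓘(ℂ)) (e.symm y)
  have hd := mdifferentiable_chart (I := 𝓘(ℂ)) y
  have hq : DifferentiableOn ℂ q q.source := by
    rw [← mdifferentiableOn_iff_differentiableOn]
    rintro z ⟨⟨hz₁, hz₂⟩, hz₃⟩
    exact ((hd.mdifferentiableAt hz₃).comp z (((he _ hz₂).mdifferentiableAt
      (e.open_source.mem_nhds hz₂)).comp z
        (hc.mdifferentiableAt_symm hz₁))).mdifferentiableWithinAt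
  have hq' := q.differentiableOn_symm_of_complex hq
  have hcy : e.symm y ∈ c.source := mem_chart_source _ _
  have hdy : y ∈ d.source := mem_chart_source _ _
  have hqt : ∀ v ∈ d.source, v ∈ e.target → e.symm v ∈ c.source → d v ∈ q.target := by
    intro v h₁ h₂ h₃
    refine ⟨d.map_source h₁, ?_⟩
    change d.symm (d v) ∈ (c.symm.trans e).target
    rw [d.left_inv h₁]
    exact ⟨h₂, h₃⟩
  have hqv : ∀ v ∈ d.source, e.symm v ∈ c.source → e.symm v = c.symm (q.symm (d v)) := by
    intro v h₁ h₃
    change _ = c.symm (c (e.symm (d.symm (d v))))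
    rw [d.left_inv h₁, c.left_inv h₃]
  have hqy := hqt y hdy hy hcy
  have h : MDifferentiableAt 𝓘(ℂ) 𝓘(ℂ) (c.symm ∘ q.symm ∘ d) y := by
    refine MDifferentiableAt.comp y (hc.mdifferentiableAt_symm (q.map_target hqy).1.1)
      (MDifferentiableAt.comp y ?_ (hd.mdifferentiableAt hdy))
    exact ((hq' _ hqy).differentiableAt (q.open_target.mem_nhds hqy)).mdifferentiableAt
  refine (h.congr_of_eventuallyEq ?_).mdifferentiableWithinAt
  filter_upwards [d.open_source.mem_nhds hdy,
    (e.continuousAt_symm hy).eventually (c.open_source.mem_nhds hcy)] with v h₁ h₃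
  exact hqv v h₁ h₃

/-- A continuous map whose composition with a holomorphic local homeomorphism is holomorphic is
itself holomorphic. -/
theorem IsLocalHomeomorph.mdifferentiable_of_comp {X Y Z : Type*} [TopologicalSpace X]
    [ChartedSpace ℂ X] [IsManifold 𝓘(ℂ) ω X] [TopologicalSpace Y] [ChartedSpace ℂ Y]
    [IsManifold 𝓘(ℂ) ω Y] [TopologicalSpace Z] [ChartedSpace ℂ Z] {p : X → Y}
    (hp : IsLocalHomeomorph p) (hpd : MDifferentiable 𝓘(ℂ) 𝓘(ℂ) p) {f : Z → X}
    (hf : Continuous f) (hpf : MDifferentiable 𝓘(ℂ) 𝓘(ℂ) (p ∘ f)) :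
    MDifferentiable 𝓘(ℂ) 𝓘(ℂ) f := by
  intro z
  -- Near `z`, the map `f` equals `s ∘ (p ∘ f)`.
  let s := hp.localInverseAt (f z)
  have hs : MDifferentiableOn 𝓘(ℂ) 𝓘(ℂ) s s.source := by
    refine s.symm.mdifferentiableOn_symm_of_complex ?_
    rw [hp.localInverseAt_symm]
    exact hpd.mdifferentiableOn
  have hz : p (f z) ∈ s.source := hp.apply_self_mem_localInverseAt_source
  refine (MDifferentiableAt.comp z ((hs _ hz).mdifferentiableAt (s.open_source.mem_nhds hz))
    (hpf z)).congr_of_eventuallyEq ?_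
  filter_upwards [hf.continuousAt.eventually
      (s.open_target.mem_nhds hp.self_mem_localInverseAt_target),
    (hp.continuous.comp hf).continuousAt.eventually (s.open_source.mem_nhds hz)] with v hv hv'
  exact hp.injOn_localInverseAt_target hv (s.map_source hv') (hp.apply_localInverseAt_of_mem hv').symm

/-! ### The complex structure of `ℍ/Γ_k` -/

namespace Uniformization

variable {S : Type*} [TopologicalSpace S] [ChartedSpace ℂ S] (u : Uniformization S) (k : ℕ∞)

theorem continuous_toCover : Continuous (u.toCover k) :=
  (u.isLocalHomeomorph_toCover k).continuous

theorem chartAt_apply (y v : u.HomologyCover k) : chartAt ℂ y v =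
    ((u.isLocalHomeomorph_toCover k).localInverseAt
      ((u.toCover_surjective k).hasRightInverse.choose y) v : ℍ) := rfl

theorem ofComplex_chartAt (y v : u.HomologyCover k) : UpperHalfPlane.ofComplex (chartAt ℂ y v) =
    (u.isLocalHomeomorph_toCover k).localInverseAt
      ((u.toCover_surjective k).hasRightInverse.choose y) v := by
  rw [chartAt_apply, UpperHalfPlane.ofComplex_apply]

/-- A map out of `ℍ/Γ_k` is holomorphic if its composition with `ℍ → ℍ/Γ_k` is. -/
theorem mdifferentiable_of_comp_toCover {X : Type*} [TopologicalSpace X] [ChartedSpace ℂ X]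
    {f : u.HomologyCover k → X} (hf : MDifferentiable 𝓘(ℂ) 𝓘(ℂ) (f ∘ u.toCover k)) :
    MDifferentiable 𝓘(ℂ) 𝓘(ℂ) f := by
  have : IsManifold 𝓘(ℂ) 1 (u.HomologyCover k) := IsManifold.of_le (n := ω) le_top
  intro y
  have hc := mdifferentiable_chart (I := 𝓘(ℂ)) y
  have hy := mem_chart_source ℂ y
  -- Charts are local sections of `ℍ → ℍ/Γ_k`, so near `y` the map `f` factors through `f ∘
  -- u.toCover k`.
  have key : ∀ v ∈ (chartAt ℂ y).source,
      0 < (chartAt ℂ y v).im ∧ u.toCover k (UpperHalfPlane.ofComplex (chartAt ℂ y v)) = v := by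
    intro v hv
    exact ⟨UpperHalfPlane.im_pos _, by
      rw [u.ofComplex_chartAt k y v]
      exact (u.isLocalHomeomorph_toCover k).apply_localInverseAt_of_mem hv.1⟩
  have h : MDifferentiableAt 𝓘(ℂ) 𝓘(ℂ)
      ((f ∘ u.toCover k) ∘ UpperHalfPlane.ofComplex ∘ chartAt ℂ y) y :=
    (hf _).comp y ((UpperHalfPlane.mdifferentiableAt_ofComplex (key y hy).1).comp y
      (hc.mdifferentiableAt hy))
  refine h.congr_of_eventuallyEq ?_
  filter_upwards [(chartAt ℂ y).open_source.mem_nhds hy] with v hv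
  exact congrArg f (key v hv).2.symm

/-- The map `ℍ → ℍ/Γ_k` is holomorphic. -/
theorem mdifferentiable_toCover : MDifferentiable 𝓘(ℂ) 𝓘(ℂ) (u.toCover k) := by
  have : IsManifold 𝓘(ℂ) 1 (u.HomologyCover k) := IsManifold.of_le (n := ω) le_top
  have hloc := u.isLocalHomeomorph_toCover k
  intro z
  let g := (u.toCover_surjective k).hasRightInverse.choose
  have hg : ∀ y, u.toCover k (g y) = y := (u.toCover_surjective k).hasRightInverse.choose_spec
  let y := u.toCover k z
  let s := hloc.localInverseAt (g y)
  have hs : MDifferentiableOn 𝓘(ℂ) 𝓘(ℂ) s s.source := by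
    intro v hv
    have hv' : v ∈ (chartAt ℂ y).source := ⟨hv, Set.mem_univ _⟩
    have h : MDifferentiableAt 𝓘(ℂ) 𝓘(ℂ) (UpperHalfPlane.ofComplex ∘ chartAt ℂ y) v :=
      (UpperHalfPlane.mdifferentiableAt_ofComplex (UpperHalfPlane.im_pos (s v))).comp v
        ((mdifferentiable_chart (I := 𝓘(ℂ)) y).mdifferentiableAt hv')
    exact (h.congr_of_eventuallyEq
      (Filter.Eventually.of_forall fun v => (u.ofComplex_chartAt k y v).symm)).mdifferentiableWithinAt
  -- The chart at `y` is centred at the chosen preimage `g y`, perhaps not `z`; an element of `Γ_k`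
  -- moves one to the other.
  obtain ⟨γ, hγ⟩ : ∃ γ : u.Γk k, γ • z = g y := (u.toCover_eq_iff k).1 (hg y)
  have hgy : MDifferentiableAt 𝓘(ℂ) 𝓘(ℂ) (u.toCover k) (γ • z) := by
    have h := s.mdifferentiableOn_symm_of_complex hs
    rw [hloc.localInverseAt_symm] at h
    rw [hγ]
    exact (h _ hloc.self_mem_localInverseAt_target).mdifferentiableAt
      (s.open_target.mem_nhds hloc.self_mem_localInverseAt_target)
  have h : MDifferentiableAt 𝓘(ℂ) 𝓘(ℂ) (u.toCover k ∘ fun w : ℍ => γ • w) z :=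
    hgy.comp z (γ.1.1.2.1 z)
  have heq : (u.toCover k ∘ fun w : ℍ => γ • w) = u.toCover k :=
    funext fun w => (u.toCover_eq_iff k).2 ⟨γ, rfl⟩
  rwa [heq] at h

end Uniformization

/-! ### Lifting homeomorphisms through coverings -/

/-- A covering map from a nonempty space to a connected space is surjective. -/
theorem IsCoveringMap.surjective_of_connectedSpace {E X : Type*} [TopologicalSpace E]
    [TopologicalSpace X] [Nonempty E] [ConnectedSpace X] {p : E → X} (cov : IsCoveringMap p) :
    Function.Surjective p := by
  rw [← Set.range_eq_univ]
  refine IsClopen.eq_univ ⟨?_, cov.isOpenMap.isOpen_range⟩ (Set.range_nonempty p)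
  rw [← isOpen_compl_iff, isOpen_iff_mem_nhds]
  intro x hx
  -- A nonempty fibre over the trivialized neighbourhood `U` would give a point over `x`.
  obtain ⟨-, U, hxU, hU, -, H, hH⟩ := cov x
  filter_upwards [hU.mem_nhds hxU]
  rintro _ hv ⟨e, rfl⟩
  exact hx ⟨_, (H ⟨e, hv⟩).2.2⟩

/-- A homeomorphism of the base of a simply connected covering space lifts. -/
theorem IsCoveringMap.exists_homeomorph_lift {E X : Type*} [TopologicalSpace E]
    [TopologicalSpace X] [SimplyConnectedSpace E] [LocallyPathConnectedSpace E] {p : E → X}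
    (cov : IsCoveringMap p) (h : X ≃ₜ X) {a b : E} (hab : p b = h (p a)) :
    ∃ F : E ≃ₜ E, F a = b ∧ ∀ z, p (F z) = h (p z) := by
  obtain ⟨F, ⟨hFa, hF⟩, -⟩ := cov.existsUnique_continuousMap_lifts
    ⟨h ∘ p, h.continuous.comp cov.continuous⟩ a b hab
  obtain ⟨G, ⟨hGb, hG⟩, -⟩ := cov.existsUnique_continuousMap_lifts
    ⟨h.symm ∘ p, h.symm.continuous.comp cov.continuous⟩ b a (by simp [hab])
  replace hF : ∀ z, p (F z) = h (p z) := congrFun hF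
  replace hG : ∀ z, p (G z) = h.symm (p z) := congrFun hG
  have hGF : G ∘ F = id := cov.eq_of_comp_eq (G.continuous.comp F.continuous) continuous_id
    (funext fun z => by simp [hF, hG]) a (by simp [hFa, hGb])
  have hFG : F ∘ G = id := cov.eq_of_comp_eq (F.continuous.comp G.continuous) continuous_id
    (funext fun z => by simp [hF, hG]) b (by simp [hFa, hGb])
  exact ⟨⟨⟨F, G, congrFun hGF, congrFun hFG⟩, F.continuous, G.continuous⟩, hFa, hF⟩

namespace ConformalAut

variable {X : Type*} [TopologicalSpace X] [ChartedSpace ℂ X]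

@[ext]
theorem ext {f g : ConformalAut X} (h : ∀ x : X, f • x = g • x) : f = g :=
  Subtype.ext (Homeomorph.ext h)

theorem continuous_smul (f : ConformalAut X) : Continuous fun x : X => f • x := f.1.continuous

end ConformalAut

/-! ### Lifts to `ℍ` and their descent to `ℍ/Γ_k` -/

namespace Uniformization

variable {S : Type*} [TopologicalSpace S] [ChartedSpace ℂ S] (u : Uniformization S) (k : ℕ∞)

/-- The automorphism `F` of `ℍ` is a lift of the automorphism `φ` of `S`. -/
def Covers (F : ConformalAut ℍ) (φ : ConformalAut S) : Prop :=
  ∀ z, u.proj (F • z) = φ • u.proj z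

variable {u k}

namespace Covers

variable {F F' : ConformalAut ℍ} {φ φ' : ConformalAut S}

theorem mul (h : u.Covers F φ) (h' : u.Covers F' φ') : u.Covers (F * F') (φ * φ') := fun z => by
  rw [mul_smul, h, h', mul_smul]

theorem inv (h : u.Covers F φ) : u.Covers F⁻¹ φ⁻¹ := fun z => by
  rw [eq_inv_smul_iff, ← h, smul_inv_smul]

theorem one : u.Covers 1 1 := fun _ => rfl

theorem pow (h : u.Covers F φ) (n : ℕ) : u.Covers (F ^ n) (φ ^ n) := by
  induction n with
  | zero => simpa using one
  | succ n ih => simpa [pow_succ] using ih.mul h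

/-- Both `F` and the identity lift `u.proj`, and two lifts agreeing at one point coincide. -/
theorem eq_one_of_smul_eq (h : u.Covers F 1) {z : ℍ} (hz : F • z = z) : F = 1 :=
  ConformalAut.ext <| congrFun <| u.isCoveringMap.eq_of_comp_eq (ConformalAut.continuous_smul F) continuous_id
    (funext h) z hz

/-- Conjugation of the deck group by a lift of an automorphism. -/
noncomputable def conj (h : u.Covers F φ) : u.Γ →* u.Γ where
  toFun γ := ⟨F * γ * F⁻¹, fun z => by
    have hγ : u.Covers γ 1 := γ.2
    simpa using ((h.mul hγ).mul h.inv) z⟩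
  map_one' := by ext; simp
  map_mul' a b := by ext; simp

/-- For `γ` in `Γ_k`, `F γ w = (F γ F⁻¹) F w`, and `F γ F⁻¹` is again in `Γ_k`. -/
theorem toCover_smul_eq (h : u.Covers F φ) {z w : ℍ} (hzw : u.toCover k z = u.toCover k w) :
    u.toCover k (F • z) = u.toCover k (F • w) := by
  obtain ⟨γ, rfl⟩ := (u.toCover_eq_iff k).1 hzw
  refine (u.toCover_eq_iff k).2 ⟨⟨h.conj γ.1,
    map_homologySubgroup_le k h.conj (Subgroup.mem_map_of_mem _ γ.2)⟩, ?_⟩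
  change (F * (γ.1 : ConformalAut ℍ) * F⁻¹) • F • w = F • (γ.1 : ConformalAut ℍ) • w
  rw [mul_smul, inv_smul_smul, mul_smul]

/-- The map of `ℍ/Γ_k` to itself induced by a lift of an automorphism of `S` to `ℍ`. -/
noncomputable def descendFun (k : ℕ∞) (h : u.Covers F φ) : u.HomologyCover k → u.HomologyCover k :=
  Quotient.lift (fun z => u.toCover k (F • z)) fun _ _ hzw => h.toCover_smul_eq (Quotient.sound hzw)

theorem descendFun_toCover (h : u.Covers F φ) (z : ℍ) :
    h.descendFun k (u.toCover k z) = u.toCover k (F • z) := rfl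

theorem continuous_descendFun (h : u.Covers F φ) : Continuous (h.descendFun k) :=
  ((u.continuous_toCover k).comp (ConformalAut.continuous_smul F)).quotient_lift _

theorem mdifferentiable_descendFun (h : u.Covers F φ) :
    MDifferentiable 𝓘(ℂ) 𝓘(ℂ) (h.descendFun k) :=
  u.mdifferentiable_of_comp_toCover k ((u.mdifferentiable_toCover k).comp F.2.1)

/-- The automorphism of `ℍ/Γ_k` induced by a lift of an automorphism of `S` to `ℍ`. -/
noncomputable def descend (k : ℕ∞) (h : u.Covers F φ) : ConformalAut (u.HomologyCover k) :=
  ⟨{  toFun := h.descendFun k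
      invFun := h.inv.descendFun k
      left_inv := fun x => by
        obtain ⟨z, rfl⟩ := u.toCover_surjective k x
        rw [descendFun_toCover, descendFun_toCover, inv_smul_smul]
      right_inv := fun x => by
        obtain ⟨z, rfl⟩ := u.toCover_surjective k x
        rw [descendFun_toCover, descendFun_toCover, smul_inv_smul]
      continuous_toFun := h.continuous_descendFun
      continuous_invFun := h.inv.continuous_descendFun },
    h.mdifferentiable_descendFun, h.inv.mdifferentiable_descendFun⟩

theorem descend_smul_toCover (h : u.Covers F φ) (z : ℍ) :
    h.descend k • u.toCover k z = u.toCover k (F • z) := rfl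

theorem isLift_descend (h : u.Covers F φ) : u.IsLift k (h.descend k) φ := fun x => by
  obtain ⟨z, rfl⟩ := u.toCover_surjective k x
  exact h z

end Covers

variable (u k)

theorem π_surjective [ConnectedSpace S] : Function.Surjective (u.π k) := fun x => by
  obtain ⟨z, rfl⟩ := u.isCoveringMap.surjective_of_connectedSpace x
  exact ⟨u.toCover k z, rfl⟩

/-! ### The deck groups `Γ` and `M_k` -/

section Lifting

variable [IsManifold 𝓘(ℂ) ω S]

/-- A lift to `ℍ` of an automorphism of `S` is holomorphic. -/
theorem exists_covers_of_homeomorph {F : ℍ ≃ₜ ℍ} {φ : ConformalAut S}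
    (hF : ∀ z, u.proj (F z) = φ • u.proj z) :
    ∃ F' : ConformalAut ℍ, u.Covers F' φ ∧ ∀ z, F' • z = F z := by
  have hF' : ∀ z, u.proj (F.symm z) = φ⁻¹ • u.proj z := fun z => by
    rw [eq_inv_smul_iff, ← hF, F.apply_symm_apply]
  refine ⟨⟨F, ?_, ?_⟩, hF, fun _ => rfl⟩
  · refine u.isCoveringMap.isLocalHomeomorph.mdifferentiable_of_comp u.mdifferentiable
      F.continuous ?_
    rw [show u.proj ∘ F = φ.1 ∘ u.proj from funext hF]
    exact φ.2.1.comp u.mdifferentiable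
  · refine u.isCoveringMap.isLocalHomeomorph.mdifferentiable_of_comp u.mdifferentiable
      F.symm.continuous ?_
    rw [show u.proj ∘ F.symm = φ⁻¹.1 ∘ u.proj from funext hF']
    exact φ⁻¹.2.1.comp u.mdifferentiable

theorem exists_covers (φ : ConformalAut S) {a b : ℍ} (hab : u.proj b = φ • u.proj a) :
    ∃ F, u.Covers F φ ∧ F • a = b := by
  obtain ⟨F, hFa, hF⟩ := u.isCoveringMap.exists_homeomorph_lift φ.1 hab
  obtain ⟨F', hF', h⟩ := u.exists_covers_of_homeomorph hF
  exact ⟨F', hF', (h a).trans hFa⟩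

/-- `S = ℍ/Γ`. -/
theorem isQuotientCoveringMap_proj [ConnectedSpace S] : IsQuotientCoveringMap u.proj u.Γ := by
  refine (isQuotientCoveringMap_iff_isCoveringMap_and _ _).2
    ⟨u.isCoveringMap, u.isCoveringMap.surjective_of_connectedSpace,
      ⟨fun γ => ConformalAut.continuous_smul γ.1⟩, ⟨fun a b z h => ?_⟩, fun {z w} => ⟨fun h => ?_, ?_⟩⟩
  · have h1 : u.Covers (b⁻¹ * a : u.Γ) 1 := (b⁻¹ * a).2
    have h2 : ((b⁻¹ * a : u.Γ) : ConformalAut ℍ) • z = z := by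
      change (b⁻¹ * a) • z = z
      rw [mul_smul, h, inv_smul_smul]
    exact (inv_mul_eq_one.1 (Subtype.ext (h1.eq_one_of_smul_eq h2))).symm
  · obtain ⟨F, hF, hFz⟩ := u.exists_covers 1 (a := w) (b := z) (by rw [h, one_smul])
    exact ⟨⟨F, hF⟩, hFz⟩
  · rintro ⟨γ, rfl⟩
    exact γ.2 w

/-- Every automorphism of `ℍ/Γ_k` inducing an automorphism of `S` lifts to `ℍ`. -/
theorem exists_descend_eq {ψ : ConformalAut (u.HomologyCover k)} {φ : ConformalAut S}
    (hψ : u.IsLift k ψ φ) : ∃ (F : ConformalAut ℍ) (h : u.Covers F φ), h.descend k = ψ := by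
  obtain ⟨b, hb⟩ := u.toCover_surjective k (ψ • u.toCover k UpperHalfPlane.I)
  -- The lift is taken through the universal covering `ℍ → ℍ/Γ_k`; it also lies over `φ`, which
  -- makes it holomorphic.
  obtain ⟨F, -, hF⟩ :=
    (u.isQuotientCoveringMap_toCover k).isCoveringMap.exists_homeomorph_lift ψ.1 hb
  obtain ⟨F', hF', h⟩ := u.exists_covers_of_homeomorph (F := F) (φ := φ) fun z => by
    exact (congrArg (u.π k) (hF z)).trans (hψ (u.toCover k z))
  refine ⟨F', hF', ConformalAut.ext fun x => ?_⟩
  obtain ⟨z, rfl⟩ := u.toCover_surjective k x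
  rw [hF'.descend_smul_toCover, h]
  exact hF z

/-- The homomorphism `Γ → M_k`. -/
noncomputable def deckHom : u.Γ →* u.M k where
  toFun γ := ⟨Covers.descend (φ := 1) k γ.2, Covers.isLift_descend (φ := 1) γ.2⟩
  map_one' := by
    refine Subtype.ext (ConformalAut.ext fun x => ?_)
    obtain ⟨z, rfl⟩ := u.toCover_surjective k x
    rfl
  map_mul' a b := by
    refine Subtype.ext (ConformalAut.ext fun x => ?_)
    obtain ⟨z, rfl⟩ := u.toCover_surjective k x
    rfl

theorem deckHom_surjective : Function.Surjective (u.deckHom k) := fun m => by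
  obtain ⟨F, hF, h⟩ := u.exists_descend_eq k (ψ := m) (φ := 1) m.2
  exact ⟨⟨F, hF⟩, Subtype.ext h⟩

theorem ker_deckHom [ConnectedSpace S] : (u.deckHom k).ker = u.Γk k := by
  ext γ
  rw [MonoidHom.mem_ker]
  constructor
  · intro h
    have h1 : u.toCover k (γ • UpperHalfPlane.I) = u.toCover k UpperHalfPlane.I :=
      congrArg (fun m : u.M k => m.1 • u.toCover k UpperHalfPlane.I) h
    obtain ⟨γ', hγ'⟩ := (u.toCover_eq_iff k).1 h1
    have := u.isQuotientCoveringMap_proj.isCancelSMul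
    -- Freeness of the action of `Γ` identifies `γ` with `γ'`, an element of `Γ_k`.
    rw [← IsCancelSMul.right_cancel γ'.1 γ UpperHalfPlane.I hγ']
    exact γ'.2
  · intro h
    refine Subtype.ext (ConformalAut.ext fun x => ?_)
    obtain ⟨z, rfl⟩ := u.toCover_surjective k x
    exact (u.toCover_eq_iff k).2 ⟨⟨γ, h⟩, rfl⟩

/-- `M_k ≅ Γ/Γ_k`. -/
noncomputable def mEquiv [ConnectedSpace S] : u.M k ≃* u.Γ ⧸ u.Γk k :=
  ((QuotientGroup.quotientMulEquivOfEq (u.ker_deckHom k).symm).trans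
    (QuotientGroup.quotientKerEquivOfSurjective _ (u.deckHom_surjective k))).symm

/-- `M_k` is isomorphic to `G / G_k` for the fundamental group `G` of `S`. -/
noncomputable def mEquivFundamentalGroup [ConnectedSpace S] (x₀ : S) :
    u.M k ≃* FundamentalGroup S x₀ ⧸ homologySubgroup (FundamentalGroup S x₀) k :=
  -- The fundamental group is the opposite of the deck group; inversion corrects the order of
  -- multiplication.
  (u.mEquiv k).trans (homologyQuotientCongr k ((MulEquiv.inv' u.Γ).trans
    (u.isQuotientCoveringMap_proj.fundamentalGroupEquiv
      ⟨_, (u.isCoveringMap.surjective_of_connectedSpace x₀).choose_spec⟩).symm))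

/-- `M_k ≅ H₁(S; ℤ_k)`. -/
noncomputable def mEquivH1Coeff [ConnectedSpace S] (x₀ : S) :
    u.M k ≃* Multiplicative (H1Coeff S x₀ k) :=
  (u.mEquivFundamentalGroup k x₀).trans (homologyQuotientEquivTensor _ k)

/-- `M_k ≅ ℤ_k^{2g}` if `S` is closed of genus `g`. -/
theorem nonempty_mEquiv_of_isClosedOfGenus [ConnectedSpace S] {x₀ : S} {g : ℕ}
    (h : IsClosedOfGenus S x₀ g) :
    Nonempty (u.M k ≃* Multiplicative (Fin (2 * g) → ZCoeff k)) := by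
  obtain ⟨-, ⟨e⟩⟩ := h
  let r : Fin g ⊕ Fin g ≃ Fin (2 * g) := finSumFinEquiv.trans (finCongr (two_mul g).symm)
  exact ⟨((u.mEquivFundamentalGroup k x₀).trans (homologyQuotientCongr k e)).trans
    ((surfaceGroupHomologyQuotientEquiv k g).trans
      (AddEquiv.toMultiplicative (LinearEquiv.funCongrLeft ℤ (ZCoeff k) r.symm).toAddEquiv))⟩

theorem pow_eq_one_of_mem_M [ConnectedSpace S] {m : ConformalAut (u.HomologyCover k)}
    (hm : m ∈ u.M k) : m ^ k.toNat = 1 := by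
  have h := homologyQuotient_nsmul_eq_zero k (Additive.ofMul (u.mEquiv k ⟨m, hm⟩))
  rw [← ofMul_pow, ofMul_eq_zero, ← map_pow, MulEquiv.map_eq_one_iff] at h
  exact congrArg Subtype.val h

end Lifting

end Uniformization

/-! ### Lifts to `ℍ/Γ_k` and the splitting -/

namespace Uniformization

variable {S : Type*} [TopologicalSpace S] [ChartedSpace ℂ S] {u : Uniformization S} {k : ℕ∞}

namespace IsLift

variable {ψ ψ' : ConformalAut (u.HomologyCover k)} {φ φ' : ConformalAut S}

theorem mul (h : u.IsLift k ψ φ) (h' : u.IsLift k ψ' φ') : u.IsLift k (ψ * ψ') (φ * φ') :=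
  fun x => by rw [mul_smul, h, h', mul_smul]

theorem inv (h : u.IsLift k ψ φ) : u.IsLift k ψ⁻¹ φ⁻¹ := fun x => by
  rw [eq_inv_smul_iff, ← h, smul_inv_smul]

theorem mem_M_iff : ψ ∈ u.M k ↔ u.IsLift k ψ 1 := Iff.rfl

theorem pow (h : u.IsLift k ψ φ) (n : ℕ) : u.IsLift k (ψ ^ n) (φ ^ n) := by
  induction n with
  | zero => exact fun _ => rfl
  | succ n ih => simpa [pow_succ] using ih.mul h

theorem zpow (h : u.IsLift k ψ φ) (n : ℤ) : u.IsLift k (ψ ^ n) (φ ^ n) := by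
  obtain ⟨n, rfl | rfl⟩ := n.eq_nat_or_neg
  · simpa using h.pow n
  · simpa using (h.pow n).inv

/-- Surjectivity of `π_k` makes `θ_k` well defined. -/
theorem unique [ConnectedSpace S] (h : u.IsLift k ψ φ) (h' : u.IsLift k ψ φ') : φ = φ' :=
  ConformalAut.ext fun x => by
    obtain ⟨y, rfl⟩ := u.π_surjective k x
    rw [← h, h']

/-- A conjugate of a lift of the identity by a lift of `φ` lies over `φ φ⁻¹ = 1`. So the normalizer
condition in `liftGroup` is automatic. -/
theorem mem_normalizer (h : u.IsLift k ψ φ) :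
    ψ ∈ Subgroup.normalizer (u.M k : Set (ConformalAut (u.HomologyCover k))) := by
  refine Subgroup.mem_normalizer_iff.2 fun m => ⟨fun hm => ?_, fun hm => ?_⟩
  · have := (h.mul (mem_M_iff.1 hm)).mul h.inv
    rwa [mul_one, mul_inv_cancel, ← mem_M_iff] at this
  · have := (h.inv.mul (mem_M_iff.1 hm)).mul h
    rw [mul_one, inv_mul_cancel, ← mem_M_iff] at this
    simpa [mul_assoc] using this

theorem mem_liftGroup (h : u.IsLift k ψ φ) {L : Subgroup (ConformalAut S)} (hφ : φ ∈ L) :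
    ψ ∈ u.liftGroup k L := ⟨h.mem_normalizer, φ, hφ, h⟩

theorem orderOf_eq [ConnectedSpace S] (h : u.IsLift k ψ φ) (hψ : ψ ^ orderOf φ = 1) :
    orderOf ψ = orderOf φ := by
  refine Nat.dvd_antisymm (orderOf_dvd_of_pow_eq_one hψ) (orderOf_dvd_of_pow_eq_one ?_)
  have h' := h.pow (orderOf ψ)
  rw [pow_orderOf_eq_one] at h'
  exact h'.unique fun _ => rfl

end IsLift

variable (u k)

theorem M_le_liftGroup (L : Subgroup (ConformalAut S)) : u.M k ≤ u.liftGroup k L :=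
  fun _ hm => (IsLift.mem_M_iff.1 hm).mem_liftGroup (one_mem L)

variable {u k}

/-- A lift of `φ` to `ℍ/Γ_k` of the same order as `φ` splits the group of lifts. -/
theorem IsLift.isInternalSemidirect [ConnectedSpace S] {Ψ : ConformalAut (u.HomologyCover k)}
    {φ : ConformalAut S} (h : u.IsLift k Ψ φ) (ho : Ψ ^ orderOf φ = 1)
    (hΨ : Ψ ∈ u.liftGroup k (Subgroup.zpowers φ)) :
    IsInternalSemidirect ((u.M k).subgroupOf (u.liftGroup k (Subgroup.zpowers φ))) ⟨Ψ, hΨ⟩ := by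
  have hn : ((u.M k).subgroupOf (u.liftGroup k (Subgroup.zpowers φ))).Normal :=
    ⟨fun m hm g => (Subgroup.mem_normalizer_iff.1 g.2.1 m).1 hm⟩
  refine ⟨hn, Subgroup.isComplement'_of_disjoint_and_mul_eq_univ ?_ ?_⟩
  · rw [Subgroup.disjoint_def]
    rintro _ hm ⟨n, rfl⟩
    have hm' : u.IsLift k (Ψ ^ n) 1 := hm
    -- If `Ψ ^ n` is in `M_k` then `φ ^ n = 1`, so the order of `φ` divides `n` and `Ψ ^ n = 1`.
    have hn := (h.zpow n).unique hm'
    rw [← orderOf_dvd_iff_zpow_eq_one] at hn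
    obtain ⟨c, rfl⟩ := hn
    refine Subtype.ext ?_
    change Ψ ^ ((orderOf φ : ℤ) * c) = 1
    rw [zpow_mul, zpow_natCast, ho, one_zpow]
  · refine Set.eq_univ_of_forall ?_
    rintro ⟨ψ, hψ⟩
    obtain ⟨-, _, ⟨n, rfl⟩, hn⟩ := id hψ
    have hm : u.IsLift k (ψ * (Ψ ^ n)⁻¹) 1 := by
      simpa using hn.mul (h.zpow n).inv
    let x : u.liftGroup k (Subgroup.zpowers φ) := ⟨ψ, hψ⟩
    let y : u.liftGroup k (Subgroup.zpowers φ) := ⟨Ψ, hΨ⟩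
    exact Set.mem_mul.2 ⟨x * (y ^ n)⁻¹, Subgroup.mem_subgroupOf.2 hm, y ^ n,
      Subgroup.zpow_mem_zpowers y n, inv_mul_cancel_right x (y ^ n)⟩

/-! ### Lifts of the same order -/

variable (u k) in
/-- An automorphism of finite order with a fixed point lifts to an automorphism of `ℍ/Γ_k` of the
same order with a fixed point. -/
theorem exists_isLift_of_fixedPoint [ConnectedSpace S] [IsManifold 𝓘(ℂ) ω S] {φ : ConformalAut S}
    (hφ : (ConformalAut.Fix φ).Nonempty) :
    ∃ Ψ : ConformalAut (u.HomologyCover k), u.IsLift k Ψ φ ∧ Ψ ^ orderOf φ = 1 ∧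
      (ConformalAut.Fix Ψ).Nonempty := by
  obtain ⟨p, hp⟩ := hφ
  obtain ⟨z, rfl⟩ := u.isCoveringMap.surjective_of_connectedSpace p
  obtain ⟨F, hF, hFz⟩ := u.exists_covers φ (a := z) (b := z) hp.symm
  have hpow : F ^ orderOf φ = 1 := by
    have h := hF.pow (orderOf φ)
    rw [pow_orderOf_eq_one] at h
    exact h.eq_one_of_smul_eq (z := z) (MulAction.mem_stabilizer_iff.1
      (pow_mem (MulAction.mem_stabilizer_iff.2 hFz) _))
  refine ⟨hF.descend k, hF.isLift_descend, ConformalAut.ext fun x => ?_, u.toCover k z,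
    congrArg (u.toCover k) hFz⟩
  obtain ⟨w, rfl⟩ := u.toCover_surjective k x
  have hn (n : ℕ) : (hF.descend k) ^ n • u.toCover k w = u.toCover k (F ^ n • w) := by
    induction n with
    | zero => simp
    | succ n ih => rw [pow_succ', mul_smul, ih, hF.descend_smul_toCover, pow_succ', mul_smul]
  rw [hn, hpow, one_smul, one_smul]

variable (u k) in
/-- An automorphism of finite order coprime to `k` lifts to an automorphism of `ℍ/Γ_k` of the same
order. -/
theorem exists_isLift_of_coprime [ConnectedSpace S] [IsManifold 𝓘(ℂ) ω S] {φ : ConformalAut S}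
    (hφ : Nat.Coprime (orderOf φ) k.toNat) :
    ∃ Ψ : ConformalAut (u.HomologyCover k), u.IsLift k Ψ φ ∧ Ψ ^ orderOf φ = 1 := by
  obtain ⟨z, hz⟩ := u.isCoveringMap.surjective_of_connectedSpace (φ • u.proj UpperHalfPlane.I)
  obtain ⟨F, hF, -⟩ := u.exists_covers φ hz
  have hΨ : u.IsLift k (hF.descend k) φ := hF.isLift_descend
  -- The first congruence keeps the `a`-th power over `φ`; the second kills the `l`-th power of the
  -- lift, which lies in `M_k`.
  obtain ⟨a, ha₁, ha₀⟩ := Nat.chineseRemainder hφ 1 0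
  refine ⟨hF.descend k ^ a, ?_, ?_⟩
  · have h := hΨ.pow a
    rwa [pow_eq_pow_iff_modEq.2 ha₁, pow_one] at h
  · obtain ⟨c, rfl⟩ := (Nat.modEq_zero_iff_dvd).1 ha₀
    have hM : hF.descend k ^ orderOf φ ∈ u.M k := by
      have h := hΨ.pow (orderOf φ)
      rwa [pow_orderOf_eq_one, ← IsLift.mem_M_iff] at h
    rw [pow_right_comm, pow_mul, u.pow_eq_one_of_mem_M k hM, one_pow]

end Uniformization

theorem theorem5 {S : Type*} [TopologicalSpace S] [T2Space S] [ConnectedSpace S] [ChartedSpace ℂ S]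
    [IsManifold 𝓘(ℂ) ω S] (x₀ : S) (hS : IsNonExceptional S x₀) (u : Uniformization S)
    (k : ℕ∞) (hk : 2 ≤ k) (L : Subgroup (ConformalAut S)) (φ : ConformalAut S) (hφL : φ ∈ L)
    (l : ℕ) (hl : 0 < l) (hφ : orderOf φ = l)
    (h : (ConformalAut.Fix φ).Nonempty ∨ (∃ n : ℕ, k = n ∧ Nat.Coprime l n)) :
    ∃ Ψ : ConformalAut (u.HomologyCover k),
      Ψ ∈ u.liftGroup k L ∧ orderOf Ψ = l ∧ u.IsLift k Ψ φ ∧ ((ConformalAut.Fix φ).Nonempty → (ConformalAut.Fix Ψ).Nonempty) ∧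
      u.M k ≤ u.liftGroup k (Subgroup.zpowers φ) ∧
      ∃ hΨ : Ψ ∈ u.liftGroup k (Subgroup.zpowers φ),
        IsInternalSemidirect ((u.M k).subgroupOf (u.liftGroup k (Subgroup.zpowers φ))) ⟨Ψ, hΨ⟩ ∧
        IsIsoSemidirect ((u.M k).subgroupOf (u.liftGroup k (Subgroup.zpowers φ))) ⟨Ψ, hΨ⟩
          (H1Coeff S x₀ k) l ∧
        ∀ g : ℕ, IsClosedOfGenus S x₀ g →
          IsIsoSemidirect ((u.M k).subgroupOf (u.liftGroup k (Subgroup.zpowers φ))) ⟨Ψ, hΨ⟩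
            (Fin (2 * g) → ZCoeff k) l := by
  subst hφ
  obtain ⟨Ψ, hΨ, ho, hfix⟩ : ∃ Ψ : ConformalAut (u.HomologyCover k), u.IsLift k Ψ φ ∧
      Ψ ^ orderOf φ = 1 ∧ ((ConformalAut.Fix φ).Nonempty → (ConformalAut.Fix Ψ).Nonempty) := by
    -- The split is on fixed points and not on `h`: when both alternatives hold, only the first
    -- construction provides a fixed point of `Ψ`.
    by_cases hf : (ConformalAut.Fix φ).Nonempty
    · obtain ⟨Ψ, h₁, h₂, h₃⟩ := u.exists_isLift_of_fixedPoint k hf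
      exact ⟨Ψ, h₁, h₂, fun _ => h₃⟩
    · obtain ⟨n, rfl, hn⟩ := h.resolve_left hf
      obtain ⟨Ψ, h₁, h₂⟩ := u.exists_isLift_of_coprime n (φ := φ) (by simpa using hn)
      exact ⟨Ψ, h₁, h₂, fun h => absurd h hf⟩
  have hmem := hΨ.mem_liftGroup (Subgroup.mem_zpowers φ)
  have hsd := hΨ.isInternalSemidirect ho hmem
  have hM := u.M_le_liftGroup k (Subgroup.zpowers φ)
  have := hsd.1
  have hord : orderOf (⟨Ψ, hmem⟩ : u.liftGroup k (Subgroup.zpowers φ)) = orderOf φ := by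
    rw [Subgroup.orderOf_mk, hΨ.orderOf_eq ho]
  refine ⟨Ψ, hΨ.mem_liftGroup hφL, hΨ.orderOf_eq ho, hΨ, hfix, hM, hmem, hsd, ?_, fun g hg => ?_⟩
  · exact isIsoSemidirect_of_isComplement' hsd.2
      ((Subgroup.subgroupOfEquivOfLe hM).trans (u.mEquivH1Coeff k x₀)) hord
  · obtain ⟨e⟩ := u.nonempty_mEquiv_of_isClosedOfGenus k hg
    exact isIsoSemidirect_of_isComplement' hsd.2 ((Subgroup.subgroupOfEquivOfLe hM).trans e) hord
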